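/- Definitions. A $D$-set is a set $\Omega$ with a $4$-ary relation $D(wx;yz)$ such that for all $w,x,y,z\in\Omega$: (D1) $D(wx;yz)$ implies $D(xw;yz)$ and $D(yz;wx)$; (D2) $D(wx;yz)$ implies $\neg D(wy;xz)$; (D3) $D(wx;yz)$ implies, for every $v\in\Omega$, that $D(vx;yz)$ or $D(wx;yv)$; (D4) if $w\ne y$ and $x\neq y$ then $D(wx;yy)$. It is proper if $|\Omega|\ge 3$ and for all distinct $w,x,y$ there is $z\neq y$ with $D(wx;yz)$. It is dense if $|\Omega|\ge 2$ and whenever $D(wx;yz)$ holds there is $v$ such that $D(vx;yz)$, $D(wv;yz)$, $D(wx;vz)$ and $D(wx;yv)$ all hold. A splitting of $\Omega$ is a partition of $\Omega$ into at least two nonempty sets, called its sectors, such that (1) $D(ab;cd)$ holds whenever $a,b$ lie in a sector $\Sigma$ and $c,d\in\Omega\setminus\Sigma$, and (2) $\neg D(ab;cd)$ holds whenever $a,b,c,d$ lie in four different sectors. A node splitting is a splitting with more than two sectors. $\Omega$ is regular if all its node splittings have the same cardinality (number of sectors). A colored $D$-set $(\Omega;P_1,\dots,P_n)$ is a $D$-set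 together with finitely many unary predicates $P_1,\dots,P_n$ which partition $\Omega$ into nonempty sets. It is ultrahomogeneous if every isomorphism between finite substructures (with respect to $D,P_1,\dots,P_n$) extends to an automorphism of $(\Omega;D,P_1,\dots,P_n)$. Theorem. Let $(\Omega;P_1,\dots,P_n)$ be a countable proper colored $D$-set. Then $(\Omega;P_1,\dots,P_n)$ is ultrahomogeneous if and only if $\Omega$ is dense, $\Omega$ is regular, and for every infinite sector $\Sigma$ of every splitting of $\Omega$ and every $i\in\{1,\dots,n\}$ we have $\Sigma\cap P_i\neq\emptyset$. -/

import Mathlib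

/-- A `D`-relation on `Ω`; `D w x y z` is the relation `D(wx; yz)`. -/
structure IsDSet {Ω : Type*} (D : Ω → Ω → Ω → Ω → Prop) : Prop where
  d1 : ∀ w x y z, D w x y z → D x w y z ∧ D y z w x
  d2 : ∀ w x y z, D w x y z → ¬ D w y x z
  d3 : ∀ w x y z, D w x y z → ∀ v, D v x y z ∨ D w x y v
  d4 : ∀ w x y, w ≠ y → x ≠ y → D w x y y

/-- A proper `D`-set. -/
structure IsProperDSet {Ω : Type*} (D : Ω → Ω → Ω → Ω → Prop) : Prop extends IsDSet D where
  three_le : 3 ≤ Cardinal.mk Ω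
  d5 : ∀ w x y, w ≠ x → w ≠ y → x ≠ y → ∃ z, z ≠ y ∧ D w x y z

/-- Density of a `D`-set. -/
def IsDenseDSet {Ω : Type*} (D : Ω → Ω → Ω → Ω → Prop) : Prop :=
  2 ≤ Cardinal.mk Ω ∧
    ∀ w x y z, D w x y z → ∃ v, D v x y z ∧ D w v y z ∧ D w x v z ∧ D w x y v

/-- A splitting of a `D`-set: a partition into at least two (nonempty) sectors. -/
structure IsSplitting {Ω : Type*} (D : Ω → Ω → Ω → Ω → Prop) (C : Set (Set Ω)) : Prop where
  isPartition : Setoid.IsPartition C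
  two_le : 2 ≤ Cardinal.mk C
  same : ∀ S ∈ C, ∀ a ∈ S, ∀ b ∈ S, ∀ c ∉ S, ∀ d ∉ S, D a b c d
  different : ∀ S ∈ C, ∀ T ∈ C, ∀ U ∈ C, ∀ V ∈ C,
    S ≠ T → S ≠ U → S ≠ V → T ≠ U → T ≠ V → U ≠ V →
    ∀ a ∈ S, ∀ b ∈ T, ∀ c ∈ U, ∀ d ∈ V, ¬ D a b c d

/-- A node splitting: a splitting into more than two sectors. -/
def IsNodeSplitting {Ω : Type*} (D : Ω → Ω → Ω → Ω → Prop) (C : Set (Set Ω)) : Prop :=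
  IsSplitting D C ∧ 2 < Cardinal.mk C

/-- A `D`-set is regular if all its node splittings have the same cardinality. -/
def IsRegularDSet {Ω : Type*} (D : Ω → Ω → Ω → Ω → Prop) : Prop :=
  ∀ C C' : Set (Set Ω), IsNodeSplitting D C → IsNodeSplitting D C' →
    Cardinal.mk C = Cardinal.mk C'

/-- A coloring: a partition of `Ω` into nonempty color classes `P i`. -/
structure IsColoring {Ω : Type*} {n : ℕ} (P : Fin n → Set Ω) : Prop where
  nonempty : ∀ i, (P i).Nonempty
  existsUnique : ∀ x, ∃! i, x ∈ P i

/-- Relation symbols for colored `D`-sets: one quaternary symbol and `n` unary symbols. -/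
inductive ColoredDRel (n : ℕ) : ℕ → Type
  | D : ColoredDRel n 4
  | color (i : Fin n) : ColoredDRel n 1

/-- The (purely relational) first-order language of `D`-sets with `n` colors. -/
def coloredDLang (n : ℕ) : FirstOrder.Language where
  Functions := fun _ => Empty
  Relations := ColoredDRel n

/-- The first-order structure `(Ω; D, P₁, …, Pₙ)`. -/
@[reducible]
def coloredDStructure {Ω : Type*} {n : ℕ} (D : Ω → Ω → Ω → Ω → Prop) (P : Fin n → Set Ω) :
    (coloredDLang n).Structure Ω where
  funMap := fun f _ => Empty.elim f
  RelMap := fun {_} r =>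
    match r with
    | ColoredDRel.D => fun v => D (v 0) (v 1) (v 2) (v 3)
    | ColoredDRel.color i => fun v => v 0 ∈ P i

/-- Ultrahomogeneity of the first-order structure `(Ω; D, P₁, …, Pₙ)`. -/
def IsUltrahomogeneousColoredDSet {Ω : Type*} {n : ℕ} (D : Ω → Ω → Ω → Ω → Prop)
    (P : Fin n → Set Ω) : Prop :=
  letI := coloredDStructure D P
  (coloredDLang n).IsUltrahomogeneous Ω

/-! Think of `Ω` as the ends of a tree, `D(wx;yz)` saying that the paths `wx` and `yz` are separated
by an edge. Three distinct points span a node, whose sectors are the classes of `nodeRel`; every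
node splitting arises this way, because points in three different sectors determine it
(`IsSplittingRel.iff_nodeRel`). Properness makes all these sectors infinite (`infinite_sector`).

For sufficiency, countability reduces ultrahomogeneity to extending a finite partial isomorphism `f`
by one point `x` (`exists_extension`). Choose `a`, `b` in the domain `A` so that the sector of `x`
at the node of `a, b, x` misses `A`. If `A` meets a third sector there, three points of `A` span the
node, and regularity leaves a sector of the image node free of `f '' A`. Otherwise the node lies on
an edge of the tree of `A`, and density supplies a node on the corresponding edge of the image. A
point of the right color in the free sector is an image of `x` (`IsSplittingRel.transfer`).

For necessity, note that every injection on three points preserves `D`. Automorphisms extending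
color-preserving maps of triples rule out an infinite sector missing a color (`inter_nonempty`).
Hence every node is spanned by three points of one fixed color, so automorphisms permute the nodes
transitively, which gives regularity. Density comes from moving one point of a quadruple. -/

namespace IsDSet

/-! ### Elementary consequences of the axioms -/

variable {Ω : Type*} {D : Ω → Ω → Ω → Ω → Prop}

theorem swap_left (h : IsDSet D) {w x y z : Ω} (hd : D w x y z) : D x w y z :=
  (h.d1 w x y z hd).1

theorem swap (h : IsDSet D) {w x y z : Ω} (hd : D w x y z) : D y z w x :=
  (h.d1 w x y z hd).2

theorem swap_right (h : IsDSet D) {w x y z : Ω} (hd : D w x y z) : D w x z y :=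
  h.swap (h.swap_left (h.swap hd))

theorem trans (h : IsDSet D) {v w x y z : Ω} (hx : D v x y z) (hw : D v w y z) : D x w y z := by
  have := h.d1; have := h.d2; have := h.d3
  grind

theorem not_of_eq (h : IsDSet D) (x y z : Ω) : ¬ D x y x z := by
  intro hd
  have h0 : ∀ t, ¬ D x x x t := fun t ht => h.d2 _ _ _ _ ht ht
  by_cases hy : y = x
  · subst hy; exact h0 _ hd
  by_cases hz : z = x
  · subst hz; exact h0 _ (h.swap hd)
  exact h.d2 _ _ _ _ hd (h.swap (h.d4 _ _ _ hy hz))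

theorem pair_iff (h : IsDSet D) (x y z : Ω) : D x y z z ↔ x ≠ z ∧ y ≠ z := by
  refine ⟨fun hd => ⟨?_, ?_⟩, fun hd => h.d4 _ _ _ hd.1 hd.2⟩
  · rintro rfl; exact h.not_of_eq _ _ _ hd
  · rintro rfl; exact h.not_of_eq _ _ _ (h.swap_left hd)

/-- A symmetric form of (D3): in the tree, `v` joins one side of the separating edge, and the same
alternative serves both points of the pair. -/
theorem insert_left (h : IsDSet D) {w x y z : Ω} (hd : D w x y z) (v : Ω) :
    (D v x y z ∧ D v w y z) ∨ (D w x y v ∧ D w x z v) := by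
  have := h.d1; have := h.d3
  grind

end IsDSet

/-! ### The splitting at the node of three points -/

/-- `x` and `y` lie in the same direction from the node spanned by `a`, `b`, `c`. -/
def nodeRel {Ω : Type*} (D : Ω → Ω → Ω → Ω → Prop) (a b c x y : Ω) : Prop :=
  D x y a b ∨ D x y a c ∨ D x y b c

/-- An equivalence relation whose classes behave like the sectors of a splitting. -/
structure IsSplittingRel {Ω : Type*} (D : Ω → Ω → Ω → Ω → Prop) (R : Ω → Ω → Prop) : Prop where
  equiv : Equivalence R
  same : ∀ x y u v, R x y → ¬ R x u → ¬ R x v → D x y u v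
  different : ∀ x y u v, ¬ R x y → ¬ R x u → ¬ R x v → ¬ R y u → ¬ R y v → ¬ R u v → ¬ D x y u v

section

variable {Ω : Type*} {D : Ω → Ω → Ω → Ω → Prop}

theorem nodeRel_symm (h : IsDSet D) {a b c x y : Ω} (hxy : nodeRel D a b c x y) :
    nodeRel D a b c y x :=
  hxy.imp h.swap_left (Or.imp h.swap_left h.swap_left)

theorem nodeRel_refl (h : IsDSet D) {a b c : Ω} (hab : a ≠ b) (hac : a ≠ c) (hbc : b ≠ c) (x : Ω) :
    nodeRel D a b c x x := by
  have h4 : ∀ {y z}, y ≠ x → z ≠ x → D x x y z := fun hy hz => h.swap (h.d4 _ _ _ hy hz)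
  by_cases hax : a = x
  · subst hax; exact Or.inr (Or.inr (h4 hab.symm hac.symm))
  by_cases hbx : b = x
  · subst hbx; exact Or.inr (Or.inl (h4 hab hbc.symm))
  exact Or.inl (h4 hax hbx)

theorem nodeRel_rot (h : IsDSet D) {a b c x y : Ω} :
    nodeRel D a b c x y ↔ nodeRel D b c a x y := by
  have := @h.swap_right
  unfold nodeRel
  grind

theorem nodeRel_swap (h : IsDSet D) {a b c x y : Ω} :
    nodeRel D a b c x y ↔ nodeRel D b a c x y := by
  have := @h.swap_right
  unfold nodeRel
  grind

theorem nodeRel_swap_right (h : IsDSet D) {a b c x y : Ω} :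
    nodeRel D a b c x y ↔ nodeRel D a c b x y := by
  have := @h.swap_right
  unfold nodeRel
  grind

theorem nodeRel_trans (h : IsDSet D) {a b c x y z : Ω}
    (hxy : nodeRel D a b c x y) (hyz : nodeRel D a b c y z) : nodeRel D a b c x z := by
  have key : ∀ {a b c x y z : Ω}, D x y a b → nodeRel D a b c y z → nodeRel D a b c x z := by
    -- Insert `c` into `D(xy;ab)` and `b` into `D(yz;ac)`. If both join the left side, then
    -- `D(cy;ab)` and `D(by;ac)` contradict (D2); in the other cases one pair on the right becomes
    -- common to both relations.
    have key' : ∀ {a b c x y z : Ω}, D x y a b → D y z a c → nodeRel D a b c x z := by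
      intro a b c x y z h1 h2
      rcases h.insert_left h1 c with ⟨h3, h4⟩ | ⟨h3, h4⟩
      · rcases h.insert_left h2 b with ⟨h5, h6⟩ | ⟨h5, h6⟩
        · have := h.d1; have := h.d2
          grind
        · exact Or.inl (h.trans (h.swap_left h1) h5)
      · exact Or.inr (Or.inl (h.trans (h.swap_left h3) h2))
    rintro a b c x y z h1 (h2 | h2 | h2)
    · exact Or.inl (h.trans (h.swap_left h1) h2)
    · exact key' h1 h2
    · exact (nodeRel_swap h).2 (key' (h.swap_right h1) h2)
  rcases hxy with h1 | h1 | h1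
  · exact key h1 hyz
  · exact (nodeRel_swap_right h).2 (key h1 ((nodeRel_swap_right h).1 hyz))
  · exact (nodeRel_rot h).2 (key h1 ((nodeRel_rot h).1 hyz))

theorem nodeRel_isSplittingRel (h : IsDSet D) {a b c : Ω} (hab : a ≠ b) (hac : a ≠ c)
    (hbc : b ≠ c) : IsSplittingRel D (nodeRel D a b c) where
  equiv := ⟨nodeRel_refl h hab hac hbc, nodeRel_symm h, nodeRel_trans h⟩
  same := by
    have key : ∀ {a b x y u v c : Ω}, D x y a b → ¬ nodeRel D a b c x u → ¬ nodeRel D a b c x v →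
        D x y u v := by
      intro a b x y u v c h1 h2 h3
      have hu : ¬ D u x a b := fun hu => h2 (Or.inl (h.swap_left hu))
      have hv : ¬ D v x a b := fun hv => h3 (Or.inl (h.swap_left hv))
      obtain ⟨h4, h5⟩ := (h.insert_left h1 u).resolve_left (fun hh => hu hh.2)
      rcases h.insert_left h4 v with h6 | h6
      · rcases h.insert_left h5 v with h7 | h7
        · exact absurd (h.swap (h.trans (h.swap_left (h.swap h6.2)) (h.swap_left (h.swap h7.2)))) hv
        · exact h7.2
      · exact h6.2
    rintro x y u v (h1 | h1 | h1) h2 h3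
    · exact key h1 h2 h3
    · rw [nodeRel_swap_right h] at h2 h3
      exact key h1 h2 h3
    · rw [nodeRel_rot h] at h2 h3
      exact key h1 h2 h3
  different := by
    intro x y u v hxy _ _ _ _ huv hd
    have key : ∀ {p q}, (D p y u v ∧ D q y u v → D u v p q) ∧ (D x y u p ∧ D x y u q → D x y p q) :=
      ⟨fun ⟨hp, hq⟩ => h.swap (h.trans (h.swap_left hp) (h.swap_left hq)),
        fun ⟨hp, hq⟩ => h.swap (h.trans (h.swap hp) (h.swap hq))⟩
    -- Pigeonhole: two of `a, b, c` join the same side of `D(xy;uv)`, and that pair puts the two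
    -- points of the opposite side in one sector.
    have ha := h.insert_left hd a
    have hb := h.insert_left hd b
    have hc := h.insert_left hd c
    unfold nodeRel at hxy huv
    grind

theorem nodeRel_self (h : IsDSet D) {a b c : Ω} : ¬ nodeRel D a b c a b := by
  rintro (h1 | h1 | h1)
  · exact h.not_of_eq _ _ _ h1
  · exact h.not_of_eq _ _ _ h1
  · exact h.not_of_eq _ _ _ (h.swap_left h1)

theorem nodeRel_self' (h : IsDSet D) {a b c : Ω} : ¬ nodeRel D a b c a c := by
  rw [nodeRel_swap_right h]
  exact nodeRel_self h

theorem nodeRel_self'' (h : IsDSet D) {a b c : Ω} : ¬ nodeRel D a b c b c := by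
  rw [nodeRel_rot h]
  exact nodeRel_self h

/-! ### Rigidity of splittings -/

namespace IsSplittingRel

variable {R R' : Ω → Ω → Prop}

theorem symm (hR : IsSplittingRel D R) {x y : Ω} (hxy : R x y) : R y x :=
  hR.equiv.symm hxy

theorem trans (hR : IsSplittingRel D R) {x y z : Ω} (hxy : R x y) (hyz : R y z) : R x z :=
  hR.equiv.trans hxy hyz

/-- If `x`, `y` were in different sectors, either one of them shares a sector with `a` or `b`, and
`same` gives the wrong pairing, or all four sectors differ, which `different` excludes. -/
theorem rel_of_rel (hR : IsSplittingRel D R) (h : IsDSet D) {a b x y : Ω} (hab : ¬ R a b)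
    (hd : D x y a b) : R x y := by
  by_contra hxy
  have hs := @hR.symm
  have ht := @hR.trans
  by_cases h1 : R x a
  · exact h.d2 _ _ _ _ hd (hR.same x a y b h1 hxy (by grind))
  by_cases h2 : R x b
  · exact h.d2 _ _ _ _ (h.swap_right hd) (hR.same x b y a h2 hxy (by grind))
  by_cases h3 : R y a
  · exact h.d2 _ _ _ _ (h.swap_left hd) (hR.same y a x b h3 (by grind) (by grind))
  by_cases h4 : R y b
  · exact h.d2 _ _ _ _ (h.swap_left (h.swap_right hd)) (hR.same y b x a h4 (by grind) (by grind))
  exact hR.different x y a b hxy h1 h2 h3 h4 hab hd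

/-- A splitting with at least three sectors is determined by points in three of them. -/
theorem iff_nodeRel (hR : IsSplittingRel D R) (h : IsDSet D) {a b c : Ω} (hab : ¬ R a b)
    (hac : ¬ R a c) (hbc : ¬ R b c) {x y : Ω} : R x y ↔ nodeRel D a b c x y := by
  constructor
  · intro hxy
    have hs := @hR.symm
    have ht := @hR.trans
    have hsame := hR.same x y
    unfold nodeRel
    by_cases h1 : R x a
    · exact Or.inr (Or.inr (hsame _ _ hxy (by grind) (by grind)))
    by_cases h2 : R x b
    · exact Or.inr (Or.inl (hsame _ _ hxy h1 (by grind)))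
    exact Or.inl (hsame _ _ hxy h1 h2)
  · rintro (h1 | h1 | h1)
    · exact hR.rel_of_rel h hab h1
    · exact hR.rel_of_rel h hac h1
    · exact hR.rel_of_rel h hbc h1

/-- Seen from inside a sector, all outside points look alike, so any of them may replace another. -/
theorem iff_of_not_rel (hR : IsSplittingRel D R) (h : IsDSet D) {p q r s x : Ω}
    (hqr : R q r) (hs : ¬ R s q) (hx : ¬ R x q) : D x p q r ↔ D s p q r := by
  have key : ∀ {s x}, ¬ R s q → ¬ R x q → D x p q r → D s p q r := by
    intro s x hs hx hd
    have h1 : D x s q r := h.swap (hR.same q r x s hqr (mt hR.symm hx) (mt hR.symm hs))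
    exact h.swap_left (h.trans hd h1)
  exact ⟨key hs hx, key hx hs⟩

/-- Adding a point in a new sector to a partial map that respects two splittings. -/
theorem transfer (hR : IsSplittingRel D R) (hR' : IsSplittingRel D R') (h : IsDSet D) {A : Set Ω}
    {f : Ω → Ω} {x y a b : Ω}
    (hf : ∀ p ∈ A, ∀ q ∈ A, ∀ r ∈ A, ∀ s ∈ A, D p q r s ↔ D (f p) (f q) (f r) (f s))
    (hRR' : ∀ p ∈ A, ∀ q ∈ A, R p q ↔ R' (f p) (f q))
    (hx : ∀ p ∈ A, ¬ R x p) (hy : ∀ p ∈ A, ¬ R' y (f p)) (ha : a ∈ A) (hb : b ∈ A)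
    (hab : ¬ R a b) {p q r : Ω} (hp : p ∈ A) (hq : q ∈ A) (hr : r ∈ A) :
    D x p q r ↔ D y (f p) (f q) (f r) := by
  have hs := @hR.symm
  have ht := @hR.trans
  have hs' := @hR'.symm
  have hx' : ∀ p ∈ A, ¬ R p x := fun p hp h => hx p hp (hs h)
  have hy' : ∀ p ∈ A, ¬ R' (f p) y := fun p hp h => hy p hp (hs' h)
  by_cases hqr : R q r
  · have hqr' := (hRR' q hq r hr).1 hqr
    by_cases hpq : R p q
    · obtain ⟨s, hsA, hsq⟩ : ∃ s ∈ A, ¬ R s q := by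
        by_cases haq : R a q
        · exact ⟨b, hb, fun hbq => hab (ht haq (hs hbq))⟩
        · exact ⟨a, ha, haq⟩
      rw [hR.iff_of_not_rel h hqr hsq (hx q hq),
        hR'.iff_of_not_rel h hqr' (mt (hRR' s hsA q hq).2 hsq) (hy q hq)]
      exact hf s hsA p hp q hq r hr
    · have h1 := hR.same q r x p hqr (hx' q hq) (mt hs hpq)
      have h2 := hR'.same (f q) (f r) y (f p) hqr' (hy' q hq)
        (fun h => hpq ((hRR' p hp q hq).2 (hs' h)))
      exact ⟨fun _ => h.swap h2, fun _ => h.swap h1⟩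
  · have hqr' := mt (hRR' q hq r hr).2 hqr
    have h1 : ¬ D x p q r := fun hd => hx p hp (hR.rel_of_rel h hqr hd)
    have h2 : ¬ D y (f p) (f q) (f r) := fun hd => hy p hp (hR'.rel_of_rel h hqr' hd)
    exact ⟨fun h => absurd h h1, fun h => absurd h h2⟩

end IsSplittingRel

end

/-- The equivalence relation whose classes are the sectors at the node spanned by `a`, `b`, `c`. -/
def nodeSetoid {Ω : Type*} {D : Ω → Ω → Ω → Ω → Prop} (h : IsDSet D) {a b c : Ω} (hab : a ≠ b)
    (hac : a ≠ c) (hbc : b ≠ c) : Setoid Ω where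
  r := nodeRel D a b c
  iseqv := (nodeRel_isSplittingRel h hab hac hbc).equiv

/-- `f` restricted to `A` is an isomorphism of colored `D`-sets onto its image. -/
structure IsPartialIso {Ω : Type*} {n : ℕ} (D : Ω → Ω → Ω → Ω → Prop) (P : Fin n → Set Ω)
    (f : Ω → Ω) (A : Set Ω) : Prop where
  injOn : Set.InjOn f A
  rel : ∀ p ∈ A, ∀ q ∈ A, ∀ r ∈ A, ∀ s ∈ A, D p q r s ↔ D (f p) (f q) (f r) (f s)
  color : ∀ p ∈ A, ∀ i, p ∈ P i ↔ f p ∈ P i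

/-! ### Closest points, infinite sectors, free sectors, adding one point -/

section

variable {Ω : Type*} {D : Ω → Ω → Ω → Ω → Prop}

theorem exists_maximal_of_transOn {α : Type*} {r : α → α → Prop} {s : Set α} (hs : s.Finite)
    (hne : s.Nonempty) (irr : ∀ a, ¬ r a a) (tr : ∀ a b c, r a b → r b c → r a c) :
    ∃ m ∈ s, ∀ c ∈ s, ¬ r m c := by
  induction s, hs using Set.Finite.induction_on with
  | empty => simp at hne
  | @insert a s _ hs ih =>
    rcases s.eq_empty_or_nonempty with rfl | hne'
    · exact ⟨a, by simp, by simpa using irr a⟩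
    · obtain ⟨m, hm, hmax⟩ := ih hne'
      by_cases hma : r m a
      · refine ⟨a, Or.inl rfl, ?_⟩
        rintro c (rfl | hc)
        · exact irr c
        · exact fun hac => hmax c hc (tr _ _ _ hma hac)
      · refine ⟨m, Or.inr hm, ?_⟩
        rintro c (rfl | hc)
        · exact hma
        · exact hmax c hc

/-- `D(pm;cq)` says that `c` leaves the path from `p` to `q` nearer to `q` than `m` does. This is a
strict order in `m, c`, so a finite set has a point branching off nearest to `q`. -/
theorem exists_closest (h : IsDSet D) {s : Set Ω} (hs : s.Finite) (hne : s.Nonempty) (p q : Ω) :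
    ∃ m ∈ s, ∀ c ∈ s, ¬ D p m c q := by
  apply exists_maximal_of_transOn hs hne
  · intro a ha
    exact h.not_of_eq a p q (h.swap_left ha)
  · intro a b c hab hbc
    rcases h.insert_left hbc a with h1 | h1
    · exact h.swap_left h1.2
    · exact absurd hab (h.d2 _ _ _ _ (h.swap_right h1.2))

/-- Properness puts a second point `z` in the sector of `x`. With `w` outside, the sector of `x` at
the node of `x, z, w` is strictly smaller, since it omits `z`; a finite sector would allow infinite
descent. -/
theorem infinite_sector (hD : IsProperDSet D) {a b c : Ω} (hab : a ≠ b) (hac : a ≠ c) (hbc : b ≠ c)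
    (x : Ω) : {z | nodeRel D a b c x z}.Infinite := by
  have h := hD.toIsDSet
  have pair : ∀ {a b c : Ω}, a ≠ b → a ≠ c → b ≠ c → ∀ x, ∃ z, z ≠ x ∧ nodeRel D a b c x z := by
    intro a b c hab hac hbc x
    by_cases hax : a = x
    · subst hax
      obtain ⟨z, hz, hd⟩ := hD.d5 b c a hbc hab.symm hac.symm
      exact ⟨z, hz, Or.inr (Or.inr (h.swap hd))⟩
    by_cases hbx : b = x
    · subst hbx
      obtain ⟨z, hz, hd⟩ := hD.d5 a c b hac hab hbc.symm
      exact ⟨z, hz, Or.inr (Or.inl (h.swap hd))⟩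
    obtain ⟨z, hz, hd⟩ := hD.d5 a b x hab hax hbx
    exact ⟨z, hz, Or.inl (h.swap hd)⟩
  intro hfin
  induction hn : Set.ncard {z | nodeRel D a b c x z} using Nat.strong_induction_on
    generalizing a b c x with
  | _ n ih =>
    have hR := nodeRel_isSplittingRel h hab hac hbc
    obtain ⟨z, hzx, hz⟩ := pair hab hac hbc x
    obtain ⟨w, hw⟩ : ∃ w, ¬ nodeRel D a b c x w := by
      by_cases hxa : nodeRel D a b c x a
      · exact ⟨b, fun hxb => nodeRel_self h (hR.trans (hR.symm hxa) hxb)⟩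
      · exact ⟨a, hxa⟩
    have hxw : x ≠ w := fun e => hw (e ▸ hR.equiv.refl x)
    have hzw : z ≠ w := fun e => hw (e ▸ hz)
    have hR' := nodeRel_isSplittingRel h hzx.symm hxw hzw
    have hss : {t | nodeRel D x z w x t} ⊂ {t | nodeRel D a b c x t} := by
      refine Set.ssubset_iff_subset_ne.2 ⟨?_, ?_⟩
      · intro t ht
        by_contra htx
        exact nodeRel_self' h (hR'.trans ht (hR'.rel_of_rel h (nodeRel_self h)
          (h.swap (hR.same x z t w hz htx hw))))
      · intro e
        have : z ∈ {t | nodeRel D x z w x t} := e ▸ hz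
        exact nodeRel_self h this
    exact ih _ (hn ▸ Set.ncard_lt_ncard hss hfin) hzx.symm hxw hzw x (hfin.subset hss.subset) rfl

/-- If `f '' A` met every target sector, there would be finitely many, and choosing preimages would
inject them into the source sectors avoiding that of `x`. Equal finite cardinalities forbid this. -/
theorem exists_free_sector (h : IsDSet D) {a b c a' b' c' : Ω} (hab : a ≠ b) (hac : a ≠ c)
    (hbc : b ≠ c) (hab' : a' ≠ b') (hac' : a' ≠ c') (hbc' : b' ≠ c')
    (hcard : Cardinal.mk (Quotient (nodeSetoid h hab hac hbc)) =
      Cardinal.mk (Quotient (nodeSetoid h hab' hac' hbc')))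
    {A : Set Ω} (hA : A.Finite) {f : Ω → Ω}
    (hf : ∀ p ∈ A, ∀ q ∈ A, nodeRel D a b c p q → nodeRel D a' b' c' (f p) (f q))
    {x : Ω} (hx : ∀ p ∈ A, ¬ nodeRel D a b c x p) :
    ∃ y, ∀ p ∈ A, ¬ nodeRel D a' b' c' y (f p) := by
  by_contra! hcon
  have hR' := nodeRel_isSplittingRel h hab' hac' hbc'
  have hcon' : ∀ q : Quotient (nodeSetoid h hab' hac' hbc'), ∃ p : A,
      (⟦f p⟧ : Quotient (nodeSetoid h hab' hac' hbc')) = q := by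
    intro q
    induction q using Quotient.inductionOn with
    | _ y =>
      obtain ⟨p, hp, hyp⟩ := hcon y
      exact ⟨⟨p, hp⟩, Quotient.sound (hR'.symm hyp)⟩
  have := hA.to_subtype
  have hfin : Finite (Quotient (nodeSetoid h hab' hac' hbc')) := Finite.of_surjective _ hcon'
  choose φ hφ using hcon'
  obtain ⟨e⟩ := Cardinal.eq.1 hcard
  let g : Quotient (nodeSetoid h hab' hac' hbc') → Quotient (nodeSetoid h hab hac hbc) :=
    fun q => ⟦(φ q : Ω)⟧
  have hg : Function.Injective g := by
    intro q q' hqq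
    rw [← hφ q, ← hφ q']
    exact Quotient.sound (hf _ (φ q).2 _ (φ q').2 (Quotient.exact hqq))
  have hsurj : Function.Surjective (e ∘ g) :=
    Finite.injective_iff_surjective.1 (e.injective.comp hg)
  obtain ⟨q, hq⟩ := hsurj (e ⟦x⟧)
  have hgx : g q = ⟦x⟧ := e.injective hq
  exact hx _ (φ q).2 ((nodeRel_isSplittingRel h hab hac hbc).symm (Quotient.exact hgx))

/-- Only quadruples with the new point occurring once need `hd`: repeated occurrences are decided by
equalities. The auxiliary steps let the new point into one more position at a time. -/
theorem IsPartialIso.insert_update {n : ℕ} {P : Fin n → Set Ω} {f : Ω → Ω} {A : Set Ω}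
    (hf : IsPartialIso D P f A) (h : IsDSet D) {x y : Ω} (hx : x ∉ A) (hy : ∀ p ∈ A, y ≠ f p)
    (hxy : ∀ i, x ∈ P i ↔ y ∈ P i)
    (hd : ∀ p ∈ A, ∀ q ∈ A, ∀ r ∈ A, D x p q r ↔ D y (f p) (f q) (f r)) [DecidableEq Ω] :
    IsPartialIso D P (Function.update f x y) (insert x A) := by
  have hup : ∀ p ∈ A, Function.update f x y p = f p := fun p hp =>
    Function.update_of_ne (by rintro rfl; exact hx hp) _ _
  have hsl : ∀ {w x y z}, D w x y z ↔ D x w y z := ⟨h.swap_left, h.swap_left⟩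
  have hsw : ∀ {w x y z}, D w x y z ↔ D y z w x := ⟨h.swap, h.swap⟩
  refine ⟨?_, ?_, ?_⟩
  · rintro p (rfl | hp) q (rfl | hq) hpq
    · rfl
    · rw [hup q hq, Function.update_self] at hpq
      exact absurd hpq (hy q hq)
    · rw [hup p hp, Function.update_self] at hpq
      exact absurd hpq.symm (hy p hp)
    · rw [hup p hp, hup q hq] at hpq
      exact hf.injOn hp hq hpq
  · have key3 : ∀ p ∈ insert x A, ∀ q ∈ A, ∀ r ∈ A, ∀ s ∈ A, D p q r s ↔
        D (Function.update f x y p) (f q) (f r) (f s) := by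
      rintro p (rfl | hp) q hq r hr s hs
      · rw [Function.update_self]
        exact hd q hq r hr s hs
      · rw [hup p hp]
        exact hf.rel p hp q hq r hr s hs
    have key2 : ∀ p ∈ insert x A, ∀ q ∈ insert x A, ∀ r ∈ A, ∀ s ∈ A, D p q r s ↔
        D (Function.update f x y p) (Function.update f x y q) (f r) (f s) := by
      rintro p hp q (rfl | hq) r hr s hs
      · rcases hp with rfl | hp
        · rw [Function.update_self, hsw, h.pair_iff, hsw, h.pair_iff]
          have hr' := hy r hr
          have hs' := hy s hs
          grind
        · rw [hsl, key3 q (Or.inl rfl) p hp r hr s hs, hsl, hup p hp]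
      · rw [key3 p hp q hq r hr s hs, hup q hq]
    have key : ∀ p ∈ insert x A, ∀ q ∈ insert x A, ∀ r ∈ insert x A, ∀ s ∈ A, D p q r s ↔
        D (Function.update f x y p) (Function.update f x y q) (Function.update f x y r) (f s) := by
      intro p hp q hq r hr s hs
      rcases hr with rfl | hr
      · have hno : ∀ u v w, ¬ D u v u w := h.not_of_eq
        have hno' : ∀ u v w, ¬ D v u u w := fun u v w hh => h.not_of_eq u v w (hsl.1 hh)
        rcases hp with rfl | hp
        · simp only [hno]
        · rcases hq with rfl | hq
          · simp only [hno']
          · rw [hsw, key2 r (Or.inl rfl) s (Or.inr hs) p hp q hq, hsw, hup p hp, hup q hq, hup s hs]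
      · rw [key2 p hp q hq r hr s hs, hup r hr]
    intro p hp q hq r hr s hs
    rcases hs with rfl | hs
    · rcases hr with rfl | hr
      · rw [h.pair_iff, h.pair_iff]
        have : ∀ t ∈ insert r A, t ≠ r ↔ Function.update f r y t ≠ Function.update f r y r := by
          rintro t (rfl | ht)
          · simp
          · rw [hup t ht, Function.update_self]
            have := hy t ht
            exact ⟨fun _ e => this e.symm, fun _ e => hx (e ▸ ht)⟩
        rw [this p hp, this q hq]
      · have hsr : ∀ {w x y z}, D w x y z ↔ D w x z y := ⟨h.swap_right, h.swap_right⟩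
        rw [hsr, key p hp q hq s (Or.inl rfl) r hr, hsr, hup r hr]
    · rw [key p hp q hq r hr s hs, hup s hs]
  · rintro p (rfl | hp) i
    · rw [Function.update_self]
      exact hxy i
    · rw [hup p hp]
      exact hf.color p hp i

end

/-! ### The one-point extension property -/

section

variable {Ω : Type*} {D : Ω → Ω → Ω → Ω → Prop} {n : ℕ} {P : Fin n → Set Ω}

theorem IsColoring.mem_iff_mem (hP : IsColoring P) {i : Fin n} {x y : Ω} (hx : x ∈ P i)
    (hy : y ∈ P i) (j : Fin n) : x ∈ P j ↔ y ∈ P j :=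
  ⟨fun h => (hP.existsUnique x).unique hx h ▸ hy, fun h => (hP.existsUnique y).unique hy h ▸ hx⟩

theorem IsProperDSet.exists_ne_ne (hD : IsProperDSet D) (a b : Ω) : ∃ c, c ≠ a ∧ c ≠ b := by
  by_contra! hcon
  have hsub : (Set.univ : Set Ω) ⊆ {a, b} := by
    intro c _
    by_cases hc : c = a
    · exact Or.inl hc
    · exact Or.inr (hcon c hc)
  have h1 := Cardinal.mk_le_mk_of_subset hsub
  have h2 : Cardinal.mk ({a, b} : Set Ω) ≤ 2 := by
    refine (Cardinal.mk_insert_le).trans ?_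
    rw [Cardinal.mk_singleton, one_add_one_eq_two]
  rw [Cardinal.mk_univ] at h1
  have h3 := hD.three_le.trans (h1.trans h2)
  norm_num at h3

/-- Every sector of every node meets every color class. -/
def NodeSectorsColorful (D : Ω → Ω → Ω → Ω → Prop) (P : Fin n → Set Ω) : Prop :=
  ∀ a b c, a ≠ b → a ≠ c → b ≠ c → ∀ x i, ∃ y ∈ P i, nodeRel D a b c x y

theorem exists_extension_of_transfer (h : IsDSet D) (hP : IsColoring P)
    (hcol : NodeSectorsColorful D P) {A : Set Ω} {f : Ω → Ω} (hf : IsPartialIso D P f A)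
    {R : Ω → Ω → Prop} (hR : IsSplittingRel D R) {x v a b a' b' c' : Ω} (hab' : a' ≠ b')
    (hac' : a' ≠ c') (hbc' : b' ≠ c')
    (hRR' : ∀ p ∈ A, ∀ q ∈ A, R p q ↔ nodeRel D a' b' c' (f p) (f q))
    (hx : ∀ p ∈ A, ¬ R x p) (hv : ∀ p ∈ A, ¬ nodeRel D a' b' c' v (f p)) (ha : a ∈ A) (hb : b ∈ A)
    (hab : ¬ R a b) :
    ∃ y, (∀ p ∈ A, y ≠ f p) ∧ (∀ i, x ∈ P i ↔ y ∈ P i) ∧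
      ∀ p ∈ A, ∀ q ∈ A, ∀ r ∈ A, D x p q r ↔ D y (f p) (f q) (f r) := by
  obtain ⟨i, hi, -⟩ := hP.existsUnique x
  obtain ⟨y, hyi, hvy⟩ := hcol a' b' c' hab' hac' hbc' v i
  have hR' := nodeRel_isSplittingRel h hab' hac' hbc'
  have hy : ∀ p ∈ A, ¬ nodeRel D a' b' c' y (f p) := fun p hp hyp => hv p hp (hR'.trans hvy hyp)
  exact ⟨y, fun p hp e => hy p hp (e ▸ hR'.equiv.refl y), hP.mem_iff_mem hi hyi,
    fun p hp q hq r hr => hR.transfer hR' h hf.rel hRR' hx hy ha hb hab hp hq hr⟩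

theorem IsPartialIso.nodeRel_iff {A : Set Ω} {f : Ω → Ω} (hf : IsPartialIso D P f A)
    {a b c x y : Ω} (ha : a ∈ A) (hb : b ∈ A) (hc : c ∈ A) (hx : x ∈ A) (hy : y ∈ A) :
    nodeRel D a b c x y ↔ nodeRel D (f a) (f b) (f c) (f x) (f y) := by
  unfold nodeRel
  rw [hf.rel x hx y hy a ha b hb, hf.rel x hx y hy a ha c hc, hf.rel x hx y hy b hb c hc]

/-- Density, applied to finite sets on the two sides of an edge. -/
theorem exists_branch_between (h : IsDSet D) (hdense : IsDenseDSet D) {A : Set Ω} (hA : A.Finite)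
    {f : Ω → Ω} (hf : IsPartialIso D P f A) {R : Ω → Ω → Prop} (hR : IsSplittingRel D R)
    {a b : Ω} (ha : a ∈ A) (hb : b ∈ A) (hab : ¬ R a b) :
    ∃ v, (∀ c ∈ A, R c a → D (f a) (f c) (f b) v) ∧ (∀ c ∈ A, R c b → D (f b) (f c) (f a) v) := by
  -- `s` and `t` branch off the path from `a` to `b` next to the edge, one on each side. Density
  -- between their images thus clears all of `A` on both sides.
  obtain ⟨s, ⟨hs, hsa⟩, hsmax⟩ := exists_closest h (s := {c ∈ A | R c a}) (hA.subset fun _ hc => hc.1)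
    ⟨a, ha, hR.equiv.refl a⟩ a b
  obtain ⟨t, ⟨ht, htb⟩, htmax⟩ := exists_closest h (s := {c ∈ A | R c b}) (hA.subset fun _ hc => hc.1)
    ⟨b, hb, hR.equiv.refl b⟩ b a
  have hd : D a s b t := hR.same _ _ _ _ (hR.symm hsa) hab
    (fun hat => hab (hR.trans hat htb))
  obtain ⟨v, h1, h2, h3, h4⟩ := hdense.2 _ _ _ _ ((hf.rel a ha s hs b hb t ht).1 hd)
  refine ⟨v, fun c hc hca => ?_, fun c hc hcb => ?_⟩
  · have hn := mt (hf.rel a ha s hs c hc b hb).2 (hsmax c ⟨hc, hca⟩)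
    rcases h.insert_left h4 (f c) with h5 | h5
    · exact h.swap_left h5.2
    · exact absurd (h.swap_right h5.1) hn
  · have hn := mt (hf.rel b hb t ht c hc a ha).2 (htmax c ⟨hc, hcb⟩)
    have h6 : D (f b) (f t) (f a) v := h.swap h2
    rcases h.insert_left h6 (f c) with h5 | h5
    · exact h.swap_left h5.2
    · exact absurd (h.swap_right h5.1) hn

theorem exists_extension (hD : IsProperDSet D) (hP : IsColoring P) (hdense : IsDenseDSet D)
    (hcard : ∀ {a b c a' b' c' : Ω} (hab : a ≠ b) (hac : a ≠ c) (hbc : b ≠ c) (hab' : a' ≠ b')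
      (hac' : a' ≠ c') (hbc' : b' ≠ c'), Cardinal.mk (Quotient (nodeSetoid hD.toIsDSet hab hac hbc)) =
        Cardinal.mk (Quotient (nodeSetoid hD.toIsDSet hab' hac' hbc')))
    (hcol : NodeSectorsColorful D P) {A : Set Ω} (hA : A.Finite) {f : Ω → Ω}
    (hf : IsPartialIso D P f A) {x : Ω} (hx : x ∉ A) :
    ∃ y, (∀ p ∈ A, y ≠ f p) ∧ (∀ i, x ∈ P i ↔ y ∈ P i) ∧
      ∀ p ∈ A, ∀ q ∈ A, ∀ r ∈ A, D x p q r ↔ D y (f p) (f q) (f r) := by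
  have h := hD.toIsDSet
  rcases A.eq_empty_or_nonempty with rfl | ⟨a, ha⟩
  · exact ⟨x, by simp⟩
  rcases (A \ {a}).eq_empty_or_nonempty with he | hne
  · have hAa : ∀ p ∈ A, p = a := fun p hp => by
      by_contra hpa
      exact (he ▸ (show p ∈ A \ {a} from ⟨hp, hpa⟩) : p ∈ (∅ : Set Ω))
    obtain ⟨i, hi, -⟩ := hP.existsUnique x
    obtain ⟨b', hb', -⟩ := hD.exists_ne_ne (f a) (f a)
    obtain ⟨c', hc', hcb'⟩ := hD.exists_ne_ne (f a) b'
    obtain ⟨y, hyi, hy⟩ := hcol (f a) b' c' hb'.symm hc'.symm hcb'.symm b' i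
    refine ⟨y, ?_, hP.mem_iff_mem hi hyi, ?_⟩
    · rintro p hp rfl
      rw [hAa p hp] at hy
      exact nodeRel_self h (nodeRel_symm h hy)
    · intro p hp q hq r hr
      rw [hAa p hp, hAa q hq, hAa r hr, h.pair_iff, h.pair_iff]
      simp
  -- Taking `b` to branch off the path from `a` to `x` nearest to `x` is what keeps the sector of
  -- `x` free of `A`.
  obtain ⟨b, ⟨hb, hba⟩, hmax⟩ := exists_closest h (s := A \ {a}) (hA.subset Set.sdiff_subset) hne a x
  have hab : a ≠ b := fun e => hba e.symm
  have hax : a ≠ x := fun e => hx (e ▸ ha)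
  have hbx : b ≠ x := fun e => hx (e ▸ hb)
  have hR := nodeRel_isSplittingRel h hab hax hbx
  have hxA : ∀ p ∈ A, ¬ nodeRel D a b x x p := by
    rintro p hp (h1 | h1 | h1)
    · by_cases hpa : p = a
      · subst hpa
        exact h.not_of_eq _ _ _ (h.swap_left h1)
      · exact hmax p ⟨hp, hpa⟩ (h.swap (h.swap_left h1))
    · exact h.not_of_eq _ _ _ (h.swap_right h1)
    · exact h.not_of_eq _ _ _ (h.swap_right h1)
  have hRab : ¬ nodeRel D a b x a b := nodeRel_self h
  by_cases hthird : ∃ c ∈ A, ¬ nodeRel D a b x a c ∧ ¬ nodeRel D a b x b c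
  · obtain ⟨c, hc, hac, hbc⟩ := hthird
    have hac' : a ≠ c := fun e => hac (e ▸ hR.equiv.refl a)
    have hbc' : b ≠ c := fun e => hbc (e ▸ hR.equiv.refl b)
    have hRc : ∀ x' y', nodeRel D a b x x' y' ↔ nodeRel D a b c x' y' := fun x' y' =>
      hR.iff_nodeRel h hRab hac hbc
    have hfab := hf.injOn.ne ha hb hab
    have hfac := hf.injOn.ne ha hc hac'
    have hfbc := hf.injOn.ne hb hc hbc'
    obtain ⟨v, hv⟩ := exists_free_sector h hab hac' hbc' hfab hfac hfbc
      (hcard hab hac' hbc' hfab hfac hfbc) hA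
      (fun p hp q hq => (hf.nodeRel_iff ha hb hc hp hq).1)
      (fun p hp hh => hxA p hp ((hRc x p).2 hh))
    exact exists_extension_of_transfer h hP hcol hf hR hfab hfac hfbc
      (fun p hp q hq => (hRc p q).trans (hf.nodeRel_iff ha hb hc hp hq)) hxA hv ha hb hRab
  · push Not at hthird
    obtain ⟨v, hva, hvb⟩ := exists_branch_between h hdense hA hf hR ha hb hRab
    have hva' := hva a ha (hR.equiv.refl a)
    have hvb' := hvb b hb (hR.equiv.refl b)
    have hfab := hf.injOn.ne ha hb hab
    have hav : f a ≠ v := fun e => by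
      rw [← e] at hva'
      exact h.not_of_eq _ _ _ (h.swap_right hva')
    have hbv : f b ≠ v := fun e => by
      rw [← e] at hvb'
      exact h.not_of_eq _ _ _ (h.swap_right hvb')
    have hR' := nodeRel_isSplittingRel h hfab hav hbv
    have hRa : ∀ c ∈ A, nodeRel D a b x a c → nodeRel D (f a) (f b) v (f a) (f c) :=
      fun c hc hac => Or.inr (Or.inr (hva c hc (hR.symm hac)))
    have hRb : ∀ c ∈ A, nodeRel D a b x b c → nodeRel D (f a) (f b) v (f b) (f c) :=
      fun c hc hbc => Or.inr (Or.inl (hvb c hc (hR.symm hbc)))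
    have hRab' : ¬ nodeRel D (f a) (f b) v (f a) (f b) := nodeRel_self h
    have hRav' : ¬ nodeRel D (f a) (f b) v (f a) v := nodeRel_self' h
    have hRbv' : ¬ nodeRel D (f a) (f b) v (f b) v := nodeRel_self'' h
    have hs := @hR.symm
    have ht := @hR.trans
    have hs' := @hR'.symm
    have ht' := @hR'.trans
    -- All of `f '' A` lies in the sectors of `f a` and `f b`, so the sector of `v` is free.
    refine exists_extension_of_transfer h hP hcol hf hR hfab hav hbv ?_ hxA (v := v) ?_ ha hb hRab
    · intro p hp q hq
      by_cases hpa : nodeRel D a b x a p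
      · by_cases hqa : nodeRel D a b x a q
        · exact iff_of_true (ht (hs hpa) hqa) (ht' (hs' (hRa p hp hpa)) (hRa q hq hqa))
        · have hqb := hthird q hq hqa
          exact iff_of_false (fun hpq => hqa (ht hpa hpq))
            (fun hpq => hRab' (ht' (hRa p hp hpa) (ht' hpq (hs' (hRb q hq hqb)))))
      · have hpb := hthird p hp hpa
        by_cases hqa : nodeRel D a b x a q
        · exact iff_of_false (fun hpq => hpa (ht hqa (hs hpq)))
            (fun hpq => hRab' (ht' (hRa q hq hqa) (ht' (hs' hpq) (hs' (hRb p hp hpb)))))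
        · have hqb := hthird q hq hqa
          exact iff_of_true (ht (hs hpb) hqb) (ht' (hs' (hRb p hp hpb)) (hRb q hq hqb))
    · intro p hp hvp
      by_cases hpa : nodeRel D a b x a p
      · exact hRav' (ht' (hRa p hp hpa) (hs' hvp))
      · exact hRbv' (ht' (hRb p hp (hthird p hp hpa)) (hs' hvp))

end

/-! ### Partial isomorphisms and first-order embeddings -/

open FirstOrder

instance (n : ℕ) : (coloredDLang n).IsRelational := fun _ => inferInstanceAs (IsEmpty Empty)

section

variable {Ω : Type*} {D : Ω → Ω → Ω → Ω → Prop} {n : ℕ} {P : Fin n → Set Ω}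

theorem IsPartialIso.exists_embedding {f : Ω → Ω} {A : Set Ω} (hf : IsPartialIso D P f A) :
    letI := coloredDStructure D P
    ∀ S : (coloredDLang n).Substructure Ω, (S : Set Ω) = A →
      ∃ g : S ↪[coloredDLang n] Ω, ∀ p, g p = f p := by
  let _ := coloredDStructure D P
  rintro S rfl
  refine ⟨⟨⟨fun p => f p, fun p q hpq => Subtype.ext (hf.injOn p.2 q.2 hpq)⟩, ?_, ?_⟩, fun p => rfl⟩
  · intro k g
    exact Empty.elim g
  · intro k r v
    cases r with
    | D => exact (hf.rel _ (v 0).2 _ (v 1).2 _ (v 2).2 _ (v 3).2).symm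
    | color i => exact (hf.color _ (v 0).2 i).symm

theorem isPartialIso_of_embedding {f : Ω → Ω} :
    letI := coloredDStructure D P
    ∀ (S : (coloredDLang n).Substructure Ω) (g : S ↪[coloredDLang n] Ω), (∀ p, g p = f p) →
      IsPartialIso D P f S := by
  let _ := coloredDStructure D P
  intro S g hg
  refine ⟨?_, ?_, ?_⟩
  · intro p hp q hq hpq
    have := g.injective ((hg ⟨p, hp⟩).trans (hpq.trans (hg ⟨q, hq⟩).symm))
    exact congrArg Subtype.val this
  · intro p hp q hq r hr s hs
    have h1 := g.map_rel' (ColoredDRel.D : (coloredDLang n).Relations 4)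
      ![⟨p, hp⟩, ⟨q, hq⟩, ⟨r, hr⟩, ⟨s, hs⟩]
    have h2 : D (g ⟨p, hp⟩) (g ⟨q, hq⟩) (g ⟨r, hr⟩) (g ⟨s, hs⟩) ↔ D p q r s := h1
    rw [← h2, hg, hg, hg, hg]
  · intro p hp i
    have h1 := g.map_rel' (ColoredDRel.color i : (coloredDLang n).Relations 1) ![⟨p, hp⟩]
    have h2 : g ⟨p, hp⟩ ∈ P i ↔ p ∈ P i := h1
    rw [← h2, hg]

/-- Back-and-forth on a countable structure. The language is relational, so finitely generated
substructures are finite and adjoining `x` adds no other point. -/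
theorem isUltrahomogeneous_of_exists_extension [Countable Ω] (h : IsDSet D)
    (hext : ∀ (A : Set Ω) (_ : A.Finite) (f : Ω → Ω) (_ : IsPartialIso D P f A) (x : Ω), x ∉ A →
      ∃ y, (∀ p ∈ A, y ≠ f p) ∧ (∀ i, x ∈ P i ↔ y ∈ P i) ∧
        ∀ p ∈ A, ∀ q ∈ A, ∀ r ∈ A, D x p q r ↔ D y (f p) (f q) (f r)) :
    IsUltrahomogeneousColoredDSet D P := by
  classical
  let _ := coloredDStructure D P
  change (coloredDLang n).IsUltrahomogeneous Ω
  rw [Language.isUltrahomogeneous_iff_IsExtensionPair Language.Structure.cg_of_countable,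
    Language.isExtensionPair_iff_exists_embedding_closure_singleton_sup]
  intro S hS g x
  have hfin : (S : Set Ω).Finite := hS.finite
  let f : Ω → Ω := fun p => if hp : p ∈ S then g ⟨p, hp⟩ else p
  have hgf : ∀ p, g p = f p := fun p => by simp [f]
  have hf := isPartialIso_of_embedding S g hgf
  have hins : ((Language.Substructure.closure (coloredDLang n) {x} ⊔ S :
      (coloredDLang n).Substructure Ω) : Set Ω) = insert x (S : Set Ω) := by
    rw [← Language.Substructure.closure_eq S, ← Language.Substructure.closure_union,
      Language.Substructure.closure_eq_of_isRelational, Language.Substructure.closure_eq]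
    rfl
  by_cases hx : x ∈ S
  · have hf' : IsPartialIso D P f (insert x (S : Set Ω)) := by
      rwa [Set.insert_eq_of_mem hx]
    obtain ⟨g', hg'⟩ := hf'.exists_embedding _ hins
    refine ⟨g', Language.Embedding.ext fun p => ?_⟩
    rw [Language.Embedding.comp_apply, hg', hgf]
    rfl
  · obtain ⟨y, hy, hcol, hd⟩ := hext S hfin f hf x hx
    obtain ⟨g', hg'⟩ := (hf.insert_update h hx hy hcol hd).exists_embedding _ hins
    refine ⟨g', Language.Embedding.ext fun p => ?_⟩
    rw [Language.Embedding.comp_apply, hg', hgf]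
    exact (Function.update_of_ne (fun e : (p : Ω) = x => hx (e ▸ p.2)) _ _).symm

theorem IsUltrahomogeneousColoredDSet.exists_equiv (hU : IsUltrahomogeneousColoredDSet D P)
    {f : Ω → Ω} {A : Set Ω} (hA : A.Finite) (hf : IsPartialIso D P f A) :
    ∃ g : Ω ≃ Ω, (∀ p q r s, D p q r s ↔ D (g p) (g q) (g r) (g s)) ∧
      (∀ p i, p ∈ P i ↔ g p ∈ P i) ∧ ∀ p ∈ A, g p = f p := by
  let _ := coloredDStructure D P
  have hS : ((Language.Substructure.closure (coloredDLang n) A : (coloredDLang n).Substructure Ω) :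
      Set Ω) = A := Language.Substructure.closure_eq_of_isRelational _ _
  obtain ⟨e, he⟩ := hf.exists_embedding _ hS
  obtain ⟨g, hg⟩ := hU _ (Language.Substructure.fg_closure hA) e
  have hg' := isPartialIso_of_embedding (D := D) (P := P) (f := g) ⊤
    (g.toEmbedding.comp (Language.Substructure.subtype ⊤)) (fun p => rfl)
  refine ⟨g.toEquiv, fun p q r s => ?_, fun p i => ?_, fun p hp => ?_⟩
  · exact hg'.rel p trivial q trivial r trivial s trivial
  · exact hg'.color p trivial i
  · have hp' : p ∈ Language.Substructure.closure (coloredDLang n) A :=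
      Language.Substructure.subset_closure hp
    rw [← he ⟨p, hp'⟩, hg]
    rfl

/-! ### Node splittings and nodes of triples -/

theorem two_lt_mk_of_ne {α : Type*} {x y z : α} (hxy : x ≠ y) (hxz : x ≠ z) (hyz : y ≠ z) :
    2 < Cardinal.mk α := by
  have h1 : Cardinal.mk ({x, y, z} : Set α) = 3 := by
    rw [Cardinal.mk_insert (by simp [hxy, hxz]), Cardinal.mk_insert (by simpa using hyz),
      Cardinal.mk_singleton]
    norm_num
  have h2 := Cardinal.mk_set_le ({x, y, z} : Set α)
  rw [h1] at h2
  exact lt_of_lt_of_le (by norm_num) h2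

theorem isNodeSplitting_classes (h : IsDSet D) {a b c : Ω} (hab : a ≠ b) (hac : a ≠ c)
    (hbc : b ≠ c) : IsNodeSplitting D (nodeSetoid h hab hac hbc).classes := by
  have hR := nodeRel_isSplittingRel h hab hac hbc
  have hlt : 2 < Cardinal.mk (nodeSetoid h hab hac hbc).classes := by
    rw [← Cardinal.mk_congr (nodeSetoid h hab hac hbc).quotientEquivClasses]
    refine two_lt_mk_of_ne (x := (⟦a⟧ : Quotient (nodeSetoid h hab hac hbc))) (y := ⟦b⟧) (z := ⟦c⟧)
      ?_ ?_ ?_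
    · exact fun e => nodeRel_self h (Quotient.exact e)
    · exact fun e => nodeRel_self' h (Quotient.exact e)
    · exact fun e => nodeRel_self'' h (Quotient.exact e)
  refine ⟨⟨Setoid.isPartition_classes _, hlt.le, ?_, ?_⟩, hlt⟩
  · rintro _ ⟨x, rfl⟩ p hp q hq r hr s hs
    have hx : ∀ {t}, nodeRel D a b c p t → nodeRel D a b c t x := fun ht =>
      hR.trans (hR.symm ht) hp
    exact hR.same p q r s (hR.trans hp (hR.symm hq)) (fun ht => hr (hx ht)) (fun ht => hs (hx ht))
  · rintro S hS T hT U hU V hV hST hSU hSV hTU hTV hUV p hp q hq r hr s hs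
    have key : ∀ {S T : Set Ω} {p q}, S ∈ (nodeSetoid h hab hac hbc).classes →
        T ∈ (nodeSetoid h hab hac hbc).classes → p ∈ S → q ∈ T → S ≠ T → ¬ nodeRel D a b c p q := by
      rintro _ _ p q ⟨x, rfl⟩ ⟨y, rfl⟩ hp hq hne hpq
      refine hne (Set.ext fun t => ?_)
      exact ⟨fun ht => hR.trans ht (hR.trans (hR.symm hp) (hR.trans hpq hq)),
        fun ht => hR.trans ht (hR.trans (hR.symm hq) (hR.trans (hR.symm hpq) hp))⟩
    exact hR.different p q r s (key hS hT hp hq hST) (key hS hU hp hr hSU) (key hS hV hp hs hSV)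
      (key hT hU hq hr hTU) (key hT hV hq hs hTV) (key hU hV hr hs hUV)

theorem IsSplitting.isSplittingRel {C : Set (Set Ω)} (hC : IsSplitting D C) :
    IsSplittingRel D (Setoid.mkClasses C hC.isPartition.2) := by
  have key : ∀ {S x y}, S ∈ C → x ∈ S → (Setoid.mkClasses C hC.isPartition.2 x y ↔ y ∈ S) := by
    intro S x y hS hx
    exact ⟨fun hh => hh S hS hx, fun hy T hT hxT =>
      Setoid.eq_of_mem_eqv_class hC.isPartition.2 hS hx hT hxT ▸ hy⟩
  refine ⟨(Setoid.mkClasses C hC.isPartition.2).iseqv, ?_, ?_⟩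
  · intro x y u v hxy hxu hxv
    obtain ⟨S, ⟨hS, hx⟩, -⟩ := hC.isPartition.2 x
    exact hC.same S hS x hx y ((key hS hx).1 hxy) u (mt (key hS hx).2 hxu) v (mt (key hS hx).2 hxv)
  · intro x y u v hxy hxu hxv hyu hyv huv
    obtain ⟨S, ⟨hS, hx⟩, -⟩ := hC.isPartition.2 x
    obtain ⟨T, ⟨hT, hy⟩, -⟩ := hC.isPartition.2 y
    obtain ⟨U, ⟨hU, hu⟩, -⟩ := hC.isPartition.2 u
    obtain ⟨V, ⟨hV, hv⟩, -⟩ := hC.isPartition.2 v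
    refine hC.different S hS T hT U hU V hV ?_ ?_ ?_ ?_ ?_ ?_ x hx y hy u hu v hv <;> rintro rfl
    · exact hxy ((key hS hx).2 hy)
    · exact hxu ((key hS hx).2 hu)
    · exact hxv ((key hS hx).2 hv)
    · exact hyu ((key hT hy).2 hu)
    · exact hyv ((key hT hy).2 hv)
    · exact huv ((key hU hu).2 hv)

/-- Every node splitting is the splitting at the node spanned by three points. -/
theorem IsNodeSplitting.exists_eq_classes (h : IsDSet D) {C : Set (Set Ω)}
    (hC : IsNodeSplitting D C) : ∃ (a b c : Ω) (hab : a ≠ b) (hac : a ≠ c) (hbc : b ≠ c),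
      C = (nodeSetoid h hab hac hbc).classes := by
  have hpart := hC.1.isPartition
  have hR := hC.1.isSplittingRel
  obtain ⟨S, T, hST⟩ := Cardinal.two_le_iff.1 hC.1.two_le
  obtain ⟨U, hU⟩ := Cardinal.exists_notMem_of_length_lt [S, T] (by simpa using hC.2)
  simp only [List.mem_cons, List.not_mem_nil, or_false, not_or] at hU
  obtain ⟨a, ha⟩ := Setoid.nonempty_of_mem_partition hpart S.2
  obtain ⟨b, hb⟩ := Setoid.nonempty_of_mem_partition hpart T.2
  obtain ⟨c, hc⟩ := Setoid.nonempty_of_mem_partition hpart U.2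
  have key : ∀ {S T : C} {x y : Ω}, x ∈ S.1 → y ∈ T.1 → S ≠ T →
      ¬ Setoid.mkClasses C hpart.2 x y := by
    intro S T x y hx hy hne hxy
    exact hne (Subtype.ext (Setoid.eq_of_mem_eqv_class hpart.2 S.2 (hxy S.1 S.2 hx) T.2 hy))
  have hab := key ha hb hST
  have hac := key ha hc (Ne.symm hU.1)
  have hbc := key hb hc (Ne.symm hU.2)
  refine ⟨a, b, c, fun e => hab (e ▸ hR.equiv.refl a), fun e => hac (e ▸ hR.equiv.refl a),
    fun e => hbc (e ▸ hR.equiv.refl b), ?_⟩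
  refine (Setoid.classes_mkClasses C hpart).symm.trans (congrArg Setoid.classes ?_)
  exact Setoid.ext fun x y => hR.iff_nodeRel h hab hac hbc

end

/-! ### Consequences of ultrahomogeneity -/

section

variable {Ω : Type*} {D : Ω → Ω → Ω → Ω → Prop} {n : ℕ} {P : Fin n → Set Ω}

/-- When `A` has at most two points, `D` involves at most three and is decided by which of them
coincide. -/
theorem IsPartialIso.rel_iff_of_two {f : Ω → Ω} {A : Set Ω} (hf : IsPartialIso D P f A)
    (h : IsDSet D) (hA : ∀ p ∈ A, ∀ q ∈ A, ∀ r ∈ A, p = q ∨ p = r ∨ q = r) {x y : Ω} (hx : x ∉ A)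
    (hy : ∀ p ∈ A, y ≠ f p) :
    ∀ p ∈ A, ∀ q ∈ A, ∀ r ∈ A, D x p q r ↔ D y (f p) (f q) (f r) := by
  intro p hp q hq r hr
  by_cases hqr : q = r
  · subst hqr
    rw [h.pair_iff, h.pair_iff]
    exact and_congr (iff_of_true (fun e => hx (e ▸ hq)) (hy q hq)) (hf.injOn.ne_iff hp hq).symm
  · rcases hA p hp q hq r hr with rfl | rfl | rfl
    · exact iff_of_false (fun hd => h.not_of_eq _ _ _ (h.swap_left hd))
        (fun hd => h.not_of_eq _ _ _ (h.swap_left hd))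
    · exact iff_of_false (fun hd => h.not_of_eq _ _ _ (h.swap_left (h.swap_right hd)))
        (fun hd => h.not_of_eq _ _ _ (h.swap_left (h.swap_right hd)))
    · exact absurd rfl hqr

theorem exists_isPartialIso_of_triple (h : IsDSet D) {a b c a' b' c' : Ω} (hab : a ≠ b)
    (hac : a ≠ c) (hbc : b ≠ c) (hab' : a' ≠ b') (hac' : a' ≠ c') (hbc' : b' ≠ c')
    (ha : ∀ i, a ∈ P i ↔ a' ∈ P i) (hb : ∀ i, b ∈ P i ↔ b' ∈ P i) (hc : ∀ i, c ∈ P i ↔ c' ∈ P i) :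
    ∃ f, IsPartialIso D P f {a, b, c} ∧ f a = a' ∧ f b = b' ∧ f c = c' := by
  classical
  have h0 : IsPartialIso D P id ∅ := ⟨by simp, by simp, by simp⟩
  have h1 := h0.insert_update (x := c) (y := c') h (by simp) (by simp) hc (by simp)
  have hc1 : Function.update (id : Ω → Ω) c c' c = c' := Function.update_self ..
  have hy1 : ∀ p ∈ insert c (∅ : Set Ω), b' ≠ Function.update id c c' p := by
    rintro p (rfl | hp)
    · rwa [hc1]
    · exact hp.elim
  have hx1 : b ∉ insert c (∅ : Set Ω) := by simpa using hbc
  have h2 := h1.insert_update h hx1 hy1 hb (h1.rel_iff_of_two h (by simp) hx1 hy1)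
  set f := Function.update (Function.update (id : Ω → Ω) c c') b b' with hf
  have hfb : f b = b' := Function.update_self ..
  have hfc : f c = c' := (Function.update_of_ne hbc.symm ..).trans hc1
  have hx2 : a ∉ insert b (insert c (∅ : Set Ω)) := by simp [hab, hac]
  have hy2 : ∀ p ∈ insert b (insert c (∅ : Set Ω)), a' ≠ f p := by
    rintro p (rfl | rfl | hp)
    · rwa [hfb]
    · rwa [hfc]
    · exact hp.elim
  have h3 := h2.insert_update h hx2 hy2 ha (h2.rel_iff_of_two h (by simp) hx2 hy2)
  refine ⟨_, by simpa using h3, Function.update_self .., ?_, ?_⟩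
  · rw [Function.update_of_ne hab.symm, hfb]
  · rw [Function.update_of_ne hac.symm, hfc]

theorem rel_triple_iff (h : IsDSet D) {w x y t : Ω} (hwx : w ≠ x) (hwy : w ≠ y) (hxy : x ≠ y)
    (htw : t ≠ w) (htx : t ≠ x) (hty : t ≠ y) (hd : D w x y t) :
    ∀ p ∈ ({w, x, y} : Set Ω), ∀ q ∈ ({w, x, y} : Set Ω), ∀ r ∈ ({w, x, y} : Set Ω),
      D t p q r ↔ p ≠ q ∧ p ≠ r ∧ (q = r ∨ p = y) := by
  have hno : ∀ u v w, ¬ D v u u w := fun u v w hh => h.not_of_eq u v w (h.swap_left hh)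
  have hno' : ∀ u v w, ¬ D v u w u := fun u v w hh => hno u v w (h.swap_right hh)
  have h1 : D t y w x := h.swap_left (h.swap hd)
  have h2 : D t y x w := h.swap_right h1
  have h3 : ¬ D t w y x := h.d2 _ _ _ _ h1
  have h4 : ¬ D t w x y := fun hh => h3 (h.swap_right hh)
  have h5 : ¬ D t x y w := h.d2 _ _ _ _ h2
  have h6 : ¬ D t x w y := fun hh => h5 (h.swap_right hh)
  rintro p (rfl | rfl | rfl) q (rfl | rfl | rfl) r (rfl | rfl | rfl) <;>
    simp [h.pair_iff, *, hwx.symm, hwy.symm, hxy.symm]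

theorem IsUltrahomogeneousColoredDSet.inter_nonempty (hU : IsUltrahomogeneousColoredDSet D P)
    (hD : IsProperDSet D) (hP : IsColoring P) (i : Fin n) {S : Set Ω} (hS : S.Infinite)
    (hcut : ∀ a ∈ S, ∀ b ∈ S, ∀ c ∉ S, ∀ d ∉ S, D a b c d) : (S ∩ P i).Nonempty := by
  classical
  have h := hD.toIsDSet
  choose col hcol using hP.existsUnique
  have hmem : ∀ x, x ∈ P (col x) := fun x => (hcol x).1
  obtain ⟨b, hb⟩ := hP.nonempty i
  -- The induction is on the number of colors occurring at least twice in `S`; it drops when passing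
  -- to the sector `T` below, where the color of `x` occurs once.
  let J : Set Ω → Finset (Fin n) := fun S =>
    Finset.univ.filter fun j => ∃ x ∈ S, ∃ y ∈ S, x ≠ y ∧ col x = j ∧ col y = j
  induction hm : (J S).card using Nat.strong_induction_on generalizing S with
  | _ m ih =>
    by_contra hne
    rw [Set.not_nonempty_iff_eq_empty] at hne
    have hblue : ∀ t ∈ P i, t ∉ S := fun t ht htS => by
      have : t ∈ S ∩ P i := ⟨htS, ht⟩
      rw [hne] at this
      exact this
    obtain ⟨x, hx, y, hy, hxy, hcxy⟩ := hS.exists_ne_map_eq_of_mapsTo (Set.mapsTo_univ col S)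
      Set.finite_univ
    have hxb : x ≠ b := fun e => hblue b hb (e ▸ hx)
    have hyb : y ≠ b := fun e => hblue b hb (e ▸ hy)
    have hR := nodeRel_isSplittingRel h hxy hxb hyb
    set T : Set Ω := {t | nodeRel D x y b x t} with hT
    have hTS : T ⊆ S := by
      intro t ht
      by_contra htS
      exact nodeRel_self' h (hR.trans ht (hR.rel_of_rel h (nodeRel_self h)
        (h.swap (hcut x hx y hy t htS b (hblue b hb)))))
    have hTinf : T.Infinite := infinite_sector hD hxy hxb hyb x
    have huniq : ∀ t ∈ T, col t = col x → t = x := by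
      intro t ht hct
      by_contra htx
      have hty : t ≠ y := by
        rintro rfl
        exact nodeRel_self h ht
      have h1 : D x t y b := hR.same x t y b ht (nodeRel_self h) (nodeRel_self' h)
      -- The automorphism swaps `x` and `y` and fixes `t`. It keeps `b` outside `S`, since `S`
      -- misses the color of `b`, so `g b` can be traded for `b`, and `D(yt;xb)` contradicts
      -- `D(xt;yb)`.
      obtain ⟨f, hf, hfx, hft, hfy⟩ := exists_isPartialIso_of_triple (P := P) h (Ne.symm htx) hxy hty
        hty.symm hxy.symm htx (hP.mem_iff_mem (hmem x) (hcxy ▸ hmem y)) (fun _ => Iff.rfl)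
        (hP.mem_iff_mem (hmem y) (hcxy ▸ hmem x))
      obtain ⟨g, hgD, hgP, hg⟩ := hU.exists_equiv (by simp) hf
      have h2 := (hgD _ _ _ _).1 h1
      rw [hg x (by simp), hg t (by simp), hg y (by simp), hfx, hft, hfy] at h2
      have hgb : g b ∉ S := hblue _ ((hgP b i).1 hb)
      have h3 : D y t b (g b) := hcut y hy t (hTS ht) b (hblue b hb) (g b) hgb
      have h4 : D y t x b := h.swap (h.trans (h.swap_left (h.swap h2)) (h.swap_left (h.swap h3)))
      exact h.d2 _ _ _ _ (h.swap_left h1) (h.swap_left h4)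
    have hcutT : ∀ a ∈ T, ∀ b ∈ T, ∀ c ∉ T, ∀ d ∉ T, D a b c d := by
      intro a ha b hb c hc d hd
      exact hR.same a b c d (hR.trans (hR.symm ha) hb) (fun hh => hc (hR.trans ha hh))
        (fun hh => hd (hR.trans ha hh))
    have hJ : J T ⊂ J S := by
      refine Finset.ssubset_iff_subset_ne.2 ⟨?_, ?_⟩
      · intro j hj
        simp only [J, Finset.mem_filter, Finset.mem_univ, true_and] at hj ⊢
        obtain ⟨p, hp, q, hq, hh⟩ := hj
        exact ⟨p, hTS hp, q, hTS hq, hh⟩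
      · intro e
        have h1 : col x ∈ J S := by
          simp only [J, Finset.mem_filter, Finset.mem_univ, true_and]
          exact ⟨x, hx, y, hy, hxy, rfl, hcxy.symm⟩
        rw [← e] at h1
        simp only [J, Finset.mem_filter, Finset.mem_univ, true_and] at h1
        obtain ⟨p, hp, q, hq, hpq, hcp, hcq⟩ := h1
        exact hpq ((huniq p hp hcp).trans (huniq q hq hcq).symm)
    obtain ⟨t, ht, hti⟩ := ih _ (hm ▸ Finset.card_lt_card hJ) hTinf hcutT rfl
    exact hblue t hti (hTS ht)

theorem IsUltrahomogeneousColoredDSet.nodeSectorsColorful (hU : IsUltrahomogeneousColoredDSet D P)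
    (hD : IsProperDSet D) (hP : IsColoring P) : NodeSectorsColorful D P := by
  intro a b c hab hac hbc x i
  have hR := nodeRel_isSplittingRel hD.toIsDSet hab hac hbc
  obtain ⟨y, hy, hyi⟩ := hU.inter_nonempty hD hP i (infinite_sector hD hab hac hbc x) (by
    intro p hp q hq r hr s hs
    exact hR.same p q r s (hR.trans (hR.symm hp) hq) (fun hh => hr (hR.trans hp hh))
      (fun hh => hs (hR.trans hp hh)))
  exact ⟨y, hyi, hy⟩

theorem IsUltrahomogeneousColoredDSet.isDenseDSet (hU : IsUltrahomogeneousColoredDSet D P)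
    (hD : IsProperDSet D) (hP : IsColoring P) : IsDenseDSet D := by
  classical
  have h := hD.toIsDSet
  have hcol := hU.nodeSectorsColorful hD hP
  refine ⟨le_trans (by norm_num) hD.three_le, ?_⟩
  -- Pairs with a repeated point are handled by properness alone.
  have hdeg : ∀ w y z, D w w y z → ∃ v, D v w y z ∧ D w v y z ∧ D w w v z ∧ D w w y v := by
    intro w y z hd
    obtain ⟨hyw, hzw⟩ := (h.pair_iff _ _ _).1 (h.swap hd)
    obtain ⟨v, hvw, hv⟩ : ∃ v, v ≠ w ∧ D w v y z := by
      by_cases hyz : y = z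
      · subst hyz
        obtain ⟨v, hvw, hvy⟩ := hD.exists_ne_ne w y
        exact ⟨v, hvw, h.d4 _ _ _ hyw.symm hvy⟩
      · obtain ⟨v, hvw, hv⟩ := hD.d5 y z w hyz hyw hzw
        exact ⟨v, hvw, h.swap hv⟩
    exact ⟨v, h.swap_left hv, hv, h.swap (h.d4 _ _ _ hvw hzw), h.swap (h.d4 _ _ _ hyw hvw)⟩
  intro w x y z hd
  by_cases hwx : w = x
  · subst hwx; exact hdeg w y z hd
  by_cases hyz : y = z
  · subst hyz
    obtain ⟨v, h1, h2, h3, h4⟩ := hdeg y w x (h.swap hd)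
    exact ⟨v, h.swap h3, h.swap h4, h.swap h1, h.swap h2⟩
  have hno := h.not_of_eq
  have hwy : w ≠ y := by rintro rfl; exact hno _ _ _ hd
  have hxy : x ≠ y := by rintro rfl; exact hno _ _ _ (h.swap_left hd)
  have hwz : w ≠ z := by rintro rfl; exact hno _ _ _ (h.swap_right hd)
  have hxz : x ≠ z := by rintro rfl; exact hno _ _ _ (h.swap_left (h.swap_right hd))
  have hR := nodeRel_isSplittingRel h hwy hwz hyz
  have nwy : ¬ nodeRel D w y z w y := nodeRel_self h
  have nwz : ¬ nodeRel D w y z w z := nodeRel_self' h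
  have nyz : ¬ nodeRel D w y z y z := nodeRel_self'' h
  have hRwx : nodeRel D w y z w x := Or.inr (Or.inr hd)
  obtain ⟨i, hi, -⟩ := hP.existsUnique z
  -- `u` is a point of the color of `z` in the sector of `y`, found in a smaller sector that omits
  -- `y`. Relative to `w, x, y`, the points `u` and `z` have the same type, while `z` lies between
  -- the pairs `wx` and `yu`.
  obtain ⟨u, hui, huy, hyu⟩ : ∃ u ∈ P i, u ≠ y ∧ nodeRel D w y z y u := by
    obtain ⟨t, ht, hty⟩ := (infinite_sector hD hwy hwz hyz y).exists_notMem_finset {y}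
    have hty' : t ≠ y := by simpa using hty
    have htw : t ≠ w := by
      rintro rfl
      exact nwy (hR.symm ht)
    have hR' := nodeRel_isSplittingRel h hty' htw hwy.symm
    obtain ⟨u, hui, hu⟩ := hcol t y w hty' htw hwy.symm t i
    refine ⟨u, hui, ?_, ?_⟩
    · rintro rfl
      exact nodeRel_self h hu
    · by_contra hyu
      exact nodeRel_self' h (hR'.trans hu (hR'.rel_of_rel h (nodeRel_self h)
        (h.swap (hR.same t y u w (hR.symm ht) (fun hh => hyu (hR.trans ht hh))
          (fun hh => nwy (hR.symm (hR.trans ht hh)))))))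
  have hs := @hR.symm
  have ht := @hR.trans
  have huw : u ≠ w := by rintro rfl; exact nwy (hs hyu)
  have hux : u ≠ x := by rintro rfl; exact nwy (ht hRwx (hs hyu))
  have nwu : ¬ nodeRel D w y z w u := fun hh => nwy (ht hh (hs hyu))
  have hwxyu : D w x y u := hR.same _ _ _ _ hRwx nwy nwu
  have hwxzu : D w x z u := hR.same _ _ _ _ hRwx nwz nwu
  have hyuzx : D y u z x := hR.same _ _ _ _ hyu nyz (fun hh => nwy (ht hRwx (hs hh)))
  have hyuwz : D y u w z := hR.same _ _ _ _ hyu (fun hh => nwy (hs hh)) nyz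
  have hid : IsPartialIso D P id {w, x, y} := ⟨Set.injOn_id _, by simp, by simp⟩
  have hiso := hid.insert_update (x := u) (y := z) h (by simp [huw, hux, huy])
    (by simp [hwz.symm, hxz.symm, Ne.symm hyz]) (hP.mem_iff_mem hui hi) (by
      intro p hp q hq r hr
      rw [rel_triple_iff h hwx hwy hxy huw hux huy hwxyu p hp q hq r hr]
      exact (rel_triple_iff h hwx hwy hxy hwz.symm hxz.symm (Ne.symm hyz) hd p hp q hq r hr).symm)
  obtain ⟨g, hgD, -, hg⟩ := hU.exists_equiv (by simp) hiso
  have hgu : g u = z := by simpa using hg u (by simp)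
  have hgw : g w = w := by simpa [huw.symm] using hg w (by simp)
  have hgx : g x = x := by simpa [hux.symm] using hg x (by simp)
  have hgy : g y = y := by simpa [huy.symm] using hg y (by simp)
  -- Since `g` fixes `w, x, y` and sends `u` to `z`, it carries the position of `z` between `wx` and
  -- `yu` to that of `g z` between `wx` and `yz`.
  refine ⟨g z, ?_, ?_, ?_, ?_⟩
  · simpa only [hgu, hgw, hgx, hgy] using (hgD _ _ _ _).1 (h.swap hyuzx)
  · simpa only [hgu, hgw, hgx, hgy] using (hgD _ _ _ _).1 (h.swap hyuwz)
  · simpa only [hgu, hgw, hgx, hgy] using (hgD _ _ _ _).1 hwxzu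
  · simpa only [hgu, hgw, hgx, hgy] using (hgD _ _ _ _).1 hd

theorem mk_classes_eq (h : IsDSet D) (hcol : NodeSectorsColorful D P)
    (hU : IsUltrahomogeneousColoredDSet D P) (hP : IsColoring P) {a b c a' b' c' : Ω} (hab : a ≠ b)
    (hac : a ≠ c) (hbc : b ≠ c) (hab' : a' ≠ b') (hac' : a' ≠ c') (hbc' : b' ≠ c') :
    Cardinal.mk (nodeSetoid h hab hac hbc).classes =
      Cardinal.mk (nodeSetoid h hab' hac' hbc').classes := by
  obtain ⟨i, -, -⟩ := hP.existsUnique a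
  -- Every node is spanned by three points of the color `i`, and any bijection between two such
  -- triples is a partial isomorphism.
  have recolor : ∀ {a b c : Ω}, a ≠ b → a ≠ c → b ≠ c → ∃ p ∈ P i, ∃ q ∈ P i, ∃ r ∈ P i,
      p ≠ q ∧ p ≠ r ∧ q ≠ r ∧ ∀ x y, nodeRel D a b c x y ↔ nodeRel D p q r x y := by
    intro a b c hab hac hbc
    have hR := nodeRel_isSplittingRel h hab hac hbc
    obtain ⟨p, hp, hap⟩ := hcol a b c hab hac hbc a i
    obtain ⟨q, hq, hbq⟩ := hcol a b c hab hac hbc b i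
    obtain ⟨r, hr, hcr⟩ := hcol a b c hab hac hbc c i
    have nab : ¬ nodeRel D a b c a b := nodeRel_self h
    have nac : ¬ nodeRel D a b c a c := nodeRel_self' h
    have nbc : ¬ nodeRel D a b c b c := nodeRel_self'' h
    have hpq : ¬ nodeRel D a b c p q := fun hh => nab (hR.trans hap (hR.trans hh (hR.symm hbq)))
    have hpr : ¬ nodeRel D a b c p r := fun hh => nac (hR.trans hap (hR.trans hh (hR.symm hcr)))
    have hqr : ¬ nodeRel D a b c q r := fun hh => nbc (hR.trans hbq (hR.trans hh (hR.symm hcr)))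
    exact ⟨p, hp, q, hq, r, hr, fun e => hpq (e ▸ hR.equiv.refl p),
      fun e => hpr (e ▸ hR.equiv.refl p), fun e => hqr (e ▸ hR.equiv.refl q),
      fun x y => hR.iff_nodeRel h hpq hpr hqr⟩
  obtain ⟨p, hp, q, hq, r, hr, hpq, hpr, hqr, hR⟩ := recolor hab hac hbc
  obtain ⟨p', hp', q', hq', r', hr', hpq', hpr', hqr', hR'⟩ := recolor hab' hac' hbc'
  obtain ⟨f, hf, hfp, hfq, hfr⟩ := exists_isPartialIso_of_triple h hpq hpr hqr hpq' hpr' hqr'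
    (hP.mem_iff_mem hp hp') (hP.mem_iff_mem hq hq') (hP.mem_iff_mem hr hr')
  obtain ⟨g, hgD, -, hg⟩ := hU.exists_equiv (by simp) hf
  rw [← Cardinal.mk_congr (nodeSetoid h hab hac hbc).quotientEquivClasses,
    ← Cardinal.mk_congr (nodeSetoid h hab' hac' hbc').quotientEquivClasses]
  refine Cardinal.mk_congr (Quotient.congr g fun x y => ?_)
  change nodeRel D a b c x y ↔ nodeRel D a' b' c' (g x) (g y)
  rw [hR, hR', ← hfp, ← hfq, ← hfr, ← hg p (by simp), ← hg q (by simp), ← hg r (by simp)]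
  unfold nodeRel
  rw [hgD x y p q, hgD x y p r, hgD x y q r]

end

theorem theorem1 {Ω : Type*} [Countable Ω] {n : ℕ}
    (D : Ω → Ω → Ω → Ω → Prop) (P : Fin n → Set Ω)
    (hD : IsProperDSet D) (hP : IsColoring P) :
    IsUltrahomogeneousColoredDSet D P ↔
      IsDenseDSet D ∧ IsRegularDSet D ∧
        ∀ C : Set (Set Ω), IsSplitting D C → ∀ S ∈ C, S.Infinite → ∀ i, (S ∩ P i).Nonempty := by
  have h := hD.toIsDSet
  constructor
  · intro hU
    refine ⟨hU.isDenseDSet hD hP, ?_, fun C hC S hS hinf i =>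
      hU.inter_nonempty hD hP i hinf (hC.same S hS)⟩
    intro C C' hC hC'
    obtain ⟨a, b, c, hab, hac, hbc, rfl⟩ := hC.exists_eq_classes h
    obtain ⟨a', b', c', hab', hac', hbc', rfl⟩ := hC'.exists_eq_classes h
    exact mk_classes_eq h (hU.nodeSectorsColorful hD hP) hU hP hab hac hbc hab' hac' hbc'
  · rintro ⟨hdense, hreg, hcolor⟩
    have hcol : NodeSectorsColorful D P := by
      intro a b c hab hac hbc x i
      have hset : {t | nodeRel D a b c t x} = {t | nodeRel D a b c x t} :=
        Set.ext fun t => ⟨nodeRel_symm h, nodeRel_symm h⟩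
      obtain ⟨y, hy, hyi⟩ := hcolor _ (isNodeSplitting_classes h hab hac hbc).1
        {t | nodeRel D a b c t x} ((nodeSetoid h hab hac hbc).mem_classes x)
        (hset ▸ infinite_sector hD hab hac hbc x) i
      exact ⟨y, hyi, nodeRel_symm h hy⟩
    refine isUltrahomogeneous_of_exists_extension h fun A hA f hf x hx =>
      exists_extension hD hP hdense ?_ hcol hA hf hx
    intro a b c a' b' c' hab hac hbc hab' hac' hbc'
    rw [Cardinal.mk_congr (nodeSetoid h hab hac hbc).quotientEquivClasses,
      Cardinal.mk_congr (nodeSetoid h hab' hac' hbc').quotientEquivClasses]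
    exact hreg _ _ (isNodeSplitting_classes h hab hac hbc) (isNodeSplitting_classes h hab' hac' hbc')
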